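/- Let $\mathbf k$ be a field, $R=\mathbf k[x_1,\dots,x_n]$ with its standard grading, $\mathfrak m=(x_1,\dots,x_n)$, let $I\subset R$ be a graded (homogeneous) ideal, and let $f\in R$ be homogeneous of degree $d$ with $f\notin I$. Then multiplication by $f$ and the canonical projection form a graded short exact sequence $$0\to R/(I:f)(-d)\xrightarrow{\;f\;} R/I\to R/(I+(f))\to 0 .$$ Suppose moreover that $f=h_1h_2$ with $h_1,h_2$ homogeneous, $\deg h_2>0$ and $(I:f)=(I:h_1)$. Let $(F_\bullet,\delta)$ and $(G_\bullet,\partial)$ be minimal graded free resolutions of $R/I$ and of $R/(I:f)$. Then the map $R/(I:f)(-d)\xrightarrow{f}R/I$ lifts to a graded chain map $\psi: G_\bullet(-d)\to F_\bullet$, and for every such lift $\psi$ the mapping cone $M(\psi)$, with $M(\psi)_i=F_i\oplus G_{i-1}(-d)$ (where $G_{-1}=0$) and differential $(x,y)\mapsto(\psi(y)+\delta(x),-\partial(y))$, augmented by $F_0\to R/I\to R/(I+(f))$, is a minimal graded free resolution of $R/(I+(f))$. Consequently: (a) $\beta_{i,j}(R/(I+(f)))=\beta_{i,j}(R/I)+\beta_{i-1,j-d}(R/(I:f))$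 for all $i\ge 0$ and $j\in\mathbb Z$, where $\beta_{-1,j}=0$; (b) $\operatorname{reg}(R/(I+(f)))=\max\{\operatorname{reg}(R/I),\ \operatorname{reg}(R/(I:f))+d-1\}$; (c) $\operatorname{pd}(R/(I+(f)))=\max\{\operatorname{pd}(R/I),\ \operatorname{pd}(R/(I:f))+1\}$. Here $\beta_{i,j}(M)$ is the number of summands $R(-j)$ in the $i$-th module of a minimal graded free resolution of $M$ (a graded free resolution is minimal if each differential maps $F_{i+1}$ into $\mathfrak m F_i$), $\operatorname{reg}(M)=\sup\{j-i:\beta_{i,j}(M)\ne0\}$ and $\operatorname{pd}(M)=\sup\{i:\beta_{i,j}(M)\neq0\text{ for some }j\}$. -/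

import Mathlib

open MvPolynomial

attribute [local instance] MvPolynomial.gradedAlgebra

noncomputable section

namespace GradedResolution

universe u v w

/-- The polynomial ring `k[x_1, …, x_n]`. -/
abbrev Poly (n : ℕ) (k : Type u) [Field k] : Type u := MvPolynomial (Fin n) k

/-- The graded maximal ideal `𝔪 = (x_1, …, x_n)`. -/
def maxIdeal (n : ℕ) (k : Type u) [Field k] : Ideal (Poly n k) :=
  Ideal.span (Set.range (X : Fin n → Poly n k))

/-- The standard grading of `k[x_1, …, x_n]`, indexed by `ℤ` (zero in negative degrees). -/
def polyGrading (n : ℕ) (k : Type u) [Field k] (j : ℤ) : Submodule k (Poly n k) :=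
  if 0 ≤ j then homogeneousSubmodule (Fin n) k j.toNat else ⊥

section Gradings

variable {n : ℕ} {k : Type u} [Field k]

/-- The grading induced on the quotient `R/J`: its degree `j` part is the image of `R_j`. -/
def quotGrading (J : Ideal (Poly n k)) (j : ℤ) : Submodule k (Poly n k ⧸ J) :=
  (polyGrading n k j).map ((Submodule.mkQ J).restrictScalars k)

/-- The grading of the twisted module `M(-a)`, that is `M(-a)_j = M_{j-a}`. -/
def twist {M : Type v} [AddCommGroup M] [Module k M] (a : ℤ) (𝓜 : ℤ → Submodule k M) (j : ℤ) :
    Submodule k M :=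
  𝓜 (j - a)

/-- The grading of the graded free module `⨁_b R(-deg b)`: the basis element `e_b` has
degree `deg b`. -/
def freeGrading {ι : Type} (deg : ι → ℤ) (j : ℤ) : Submodule k (ι →₀ Poly n k) where
  carrier := {x | ∀ b, x b ∈ polyGrading n k (j - deg b)}
  add_mem' hx hy b := by
    rw [Finsupp.add_apply]
    exact Submodule.add_mem _ (hx b) (hy b)
  zero_mem' b := by
    rw [Finsupp.zero_apply]
    exact Submodule.zero_mem _
  smul_mem' c x hx b := by
    rw [Finsupp.smul_apply]
    exact Submodule.smul_mem _ c (hx b)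

/-- A map of graded modules is graded (of degree `0`) if it preserves degrees. -/
def IsGradedMap {M : Type v} {N : Type w} [AddCommGroup M] [AddCommGroup N]
    [Module k M] [Module k N] [Module (Poly n k) M] [Module (Poly n k) N]
    (𝓜 : ℤ → Submodule k M) (𝓝 : ℤ → Submodule k N) (φ : M →ₗ[Poly n k] N) : Prop :=
  ∀ j, ∀ x ∈ 𝓜 j, φ x ∈ 𝓝 j

theorem mem_freeGrading {ι : Type} {deg : ι → ℤ} {j : ℤ} {x : ι →₀ Poly n k} :
    x ∈ freeGrading deg j ↔ ∀ b, x b ∈ polyGrading n k (j - deg b) := Iff.rfl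

theorem mem_freeGrading_add {ι : Type} {deg : ι → ℤ} {a j : ℤ} {x : ι →₀ Poly n k} :
    x ∈ freeGrading (fun b => deg b + a) j ↔ x ∈ freeGrading deg (j - a) := by
  simp only [mem_freeGrading]
  refine forall_congr' fun b => ?_
  rw [show j - (deg b + a) = j - a - deg b by ring]

end Gradings

/-- A (nonnegatively indexed) chain complex `⋯ → F_2 → F_1 → F_0` of finitely generated graded
free `R`-modules with a chosen homogeneous basis: `F_i` has the basis `ι i`, whose element `b` has
degree `deg i b`, and `d i : F_{i+1} → F_i` is the differential. -/
structure FreeComplex (n : ℕ) (k : Type u) [Field k] where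
  ι : ℕ → Type
  finite : ∀ i, Finite (ι i)
  deg : ∀ i, ι i → ℤ
  d : ∀ i, (ι (i + 1) →₀ Poly n k) →ₗ[Poly n k] (ι i →₀ Poly n k)
  d_graded : ∀ i, IsGradedMap (freeGrading (k := k) (deg (i + 1))) (freeGrading (deg i)) (d i)
  d_comp_d : ∀ i, d i ∘ₗ d (i + 1) = 0

namespace FreeComplex

variable {n : ℕ} {k : Type u} [Field k]

/-- The `i`-th module `F_i` of the complex. -/
abbrev mod (F : FreeComplex n k) (i : ℕ) : Type u := F.ι i →₀ Poly n k

/-- The grading of the `i`-th module `F_i`. -/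
abbrev grading (F : FreeComplex n k) (i : ℕ) : ℤ → Submodule k (F.mod i) :=
  freeGrading (F.deg i)

/-- The number of copies of `R(-j)` in `F_i`. -/
def rank (F : FreeComplex n k) (i : ℕ) (j : ℤ) : ℕ :=
  Nat.card {b : F.ι i // F.deg i b = j}

/-- `F` is minimal: every differential maps `F_{i+1}` into `𝔪 F_i`. -/
def IsMinimal (F : FreeComplex n k) : Prop :=
  ∀ i, LinearMap.range (F.d i) ≤ maxIdeal n k • (⊤ : Submodule (Poly n k) (F.mod i))

/-- `F`, augmented by `ε : F_0 → M`, is a graded free resolution of the graded module `M`, that is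
`⋯ → F_1 → F_0 → M → 0` is an exact sequence of graded maps. -/
structure IsResolution (F : FreeComplex n k) {M : Type v} [AddCommGroup M] [Module k M]
    [Module (Poly n k) M] (𝓜 : ℤ → Submodule k M) (ε : F.mod 0 →ₗ[Poly n k] M) : Prop where
  graded : IsGradedMap (F.grading 0) 𝓜 ε
  surjective : Function.Surjective ε
  exact_zero : Function.Exact (F.d 0) ε
  exact_succ : ∀ i, Function.Exact (F.d (i + 1)) (F.d i)

/-- A minimal graded free resolution. -/
def IsMinimalResolution (F : FreeComplex n k) {M : Type v} [AddCommGroup M] [Module k M]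
    [Module (Poly n k) M] (𝓜 : ℤ → Submodule k M) (ε : F.mod 0 →ₗ[Poly n k] M) : Prop :=
  F.IsResolution 𝓜 ε ∧ F.IsMinimal

/-- The twisted complex `F(-a)`: the same modules and maps, with all degrees raised by `a`. -/
def twist (F : FreeComplex n k) (a : ℤ) : FreeComplex n k where
  ι := F.ι
  finite := F.finite
  deg i b := F.deg i b + a
  d := F.d
  d_graded i j x hx := by
    rw [mem_freeGrading_add] at hx ⊢
    exact F.d_graded i _ x hx
  d_comp_d := F.d_comp_d

/-- A graded chain map `ψ : G → F` of complexes of graded free modules. -/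
structure Hom (G F : FreeComplex n k) where
  f : ∀ i, G.mod i →ₗ[Poly n k] F.mod i
  graded : ∀ i, IsGradedMap (G.grading i) (F.grading i) (f i)
  comm : ∀ i, F.d i ∘ₗ f (i + 1) = f i ∘ₗ G.d i

/-- The chain map `ψ : G → F` lifts the map `φ : N → M` between the augmented modules. -/
def Hom.IsLift {G F : FreeComplex n k} (ψ : Hom G F) {M : Type v} {N : Type w}
    [AddCommGroup M] [AddCommGroup N] [Module (Poly n k) M] [Module (Poly n k) N]
    (εF : F.mod 0 →ₗ[Poly n k] M) (εG : G.mod 0 →ₗ[Poly n k] N) (φ : N →ₗ[Poly n k] M) : Prop :=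
  εF ∘ₗ ψ.f 0 = φ ∘ₗ εG

/-! The mapping cone `M(ψ)_i = F_i ⊕ G_{i-1}` (so that `M(ψ)_0 = F_0`), with the differential
`(x, y) ↦ (ψ y + d x, - d y)`. -/

/-- The basis of `M(ψ)_i`. -/
def coneIndex (F G : FreeComplex n k) : ℕ → Type
  | 0 => F.ι 0
  | i + 1 => F.ι (i + 1) ⊕ G.ι i

/-- The degrees of the basis elements of `M(ψ)_i`. -/
def coneDeg (F G : FreeComplex n k) : ∀ i, coneIndex F G i → ℤ
  | 0 => F.deg 0
  | i + 1 => Sum.elim (F.deg (i + 1)) (G.deg i)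

/-- The identification `M(ψ)_{i+1} = F_{i+1} × G_i`. -/
def coneEquiv (F G : FreeComplex n k) (i : ℕ) :
    (coneIndex F G (i + 1) →₀ Poly n k) ≃ₗ[Poly n k] F.mod (i + 1) × G.mod i :=
  Finsupp.sumFinsuppLEquivProdFinsupp (Poly n k)

/-- The differential `(x, y) ↦ (ψ y + d x, - d y)`; the second entry is absent in `M(ψ)_0 = F_0`. -/
def coneD {G F : FreeComplex n k} (ψ : Hom G F) :
    ∀ i, (coneIndex F G (i + 1) →₀ Poly n k) →ₗ[Poly n k] (coneIndex F G i →₀ Poly n k)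
  | 0 => (F.d 0).coprod (ψ.f 0) ∘ₗ (coneEquiv F G 0).toLinearMap
  | i + 1 => (coneEquiv F G i).symm.toLinearMap ∘ₗ
      (((F.d (i + 1)).coprod (ψ.f (i + 1))).prod
        (-(G.d i ∘ₗ LinearMap.snd (Poly n k) (F.mod (i + 2)) (G.mod (i + 1))))) ∘ₗ
      (coneEquiv F G (i + 1)).toLinearMap

theorem coneD_zero_apply {G F : FreeComplex n k} (ψ : Hom G F)
    (z : coneIndex F G 1 →₀ Poly n k) :
    coneD ψ 0 z = F.d 0 (coneEquiv F G 0 z).1 + ψ.f 0 (coneEquiv F G 0 z).2 := rfl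

theorem coneEquiv_coneD_succ {G F : FreeComplex n k} (ψ : Hom G F) (i : ℕ)
    (z : coneIndex F G (i + 2) →₀ Poly n k) :
    coneEquiv F G i (coneD ψ (i + 1) z) =
      (F.d (i + 1) (coneEquiv F G (i + 1) z).1 + ψ.f (i + 1) (coneEquiv F G (i + 1) z).2,
        -G.d i (coneEquiv F G (i + 1) z).2) :=
  (coneEquiv F G i).apply_symm_apply _

theorem mem_coneGrading (F G : FreeComplex n k) (i : ℕ) (j : ℤ)
    (z : coneIndex F G (i + 1) →₀ Poly n k) :
    z ∈ freeGrading (coneDeg F G (i + 1)) j ↔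
      (coneEquiv F G i z).1 ∈ F.grading (i + 1) j ∧ (coneEquiv F G i z).2 ∈ G.grading i j := by
  constructor
  · intro h
    exact ⟨fun b => h (Sum.inl b), fun b => h (Sum.inr b)⟩
  · rintro ⟨h1, h2⟩ (b | b)
    · exact h1 b
    · exact h2 b

theorem coneD_graded {G F : FreeComplex n k} (ψ : Hom G F) (i : ℕ) :
    IsGradedMap (freeGrading (k := k) (coneDeg F G (i + 1))) (freeGrading (coneDeg F G i))
      (coneD ψ i) := by
  intro j z hz
  rw [mem_coneGrading] at hz
  cases i with
  | zero =>
    rw [coneD_zero_apply]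
    exact Submodule.add_mem _ (F.d_graded 0 j _ hz.1) (ψ.graded 0 j _ hz.2)
  | succ i =>
    rw [mem_coneGrading, coneEquiv_coneD_succ]
    exact ⟨Submodule.add_mem _ (F.d_graded _ j _ hz.1) (ψ.graded _ j _ hz.2),
      Submodule.neg_mem _ (G.d_graded _ j _ hz.2)⟩

theorem coneD_comp {G F : FreeComplex n k} (ψ : Hom G F) (i : ℕ) :
    coneD ψ i ∘ₗ coneD ψ (i + 1) = 0 := by
  have hF : ∀ i x, F.d i (F.d (i + 1) x) = 0 := fun i x => LinearMap.congr_fun (F.d_comp_d i) x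
  have hG : ∀ i x, G.d i (G.d (i + 1) x) = 0 := fun i x => LinearMap.congr_fun (G.d_comp_d i) x
  have hc : ∀ i x, F.d i (ψ.f (i + 1) x) = ψ.f i (G.d i x) :=
    fun i x => LinearMap.congr_fun (ψ.comm i) x
  refine LinearMap.ext fun z => ?_
  cases i with
  | zero =>
    rw [LinearMap.comp_apply, coneD_zero_apply, coneEquiv_coneD_succ]
    simp [hF, hc]
    rfl
  | succ i =>
    apply (coneEquiv F G i).injective
    rw [LinearMap.comp_apply, coneEquiv_coneD_succ, coneEquiv_coneD_succ]
    simp [hF, hG, hc]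

/-- The mapping cone `M(ψ)` of a graded chain map `ψ : G → F`. -/
def cone {G F : FreeComplex n k} (ψ : Hom G F) : FreeComplex n k where
  ι := coneIndex F G
  finite i := by
    cases i with
    | zero => exact F.finite 0
    | succ i =>
      have := F.finite (i + 1)
      have := G.finite i
      exact inferInstanceAs (Finite (F.ι (i + 1) ⊕ G.ι i))
  deg := coneDeg F G
  d := coneD ψ
  d_graded := coneD_graded ψ
  d_comp_d := coneD_comp ψ

end FreeComplex

section Invariants

variable {n : ℕ} {k : Type u} [Field k] {M : Type v} [AddCommGroup M] [Module k M]
  [Module (Poly n k) M]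

open Classical in
/-- The graded Betti number `β_{i,j}(M)` of a finitely generated graded module: the number of
copies of `R(-j)` in the `i`-th module of a minimal graded free resolution of `M`. -/
def betti (𝓜 : ℤ → Submodule k M) (i : ℕ) (j : ℤ) : ℕ :=
  if h : ∃ (F : FreeComplex n k) (ε : F.mod 0 →ₗ[Poly n k] M), F.IsMinimalResolution 𝓜 ε then
    h.choose.rank i j
  else 0

/-- The Castelnuovo–Mumford regularity `reg M = max {j - i : β_{i,j}(M) ≠ 0}`, as a supremum in
`ℤ ∪ {±∞}` (it is `-∞` for `M = 0`). -/
def reg (𝓜 : ℤ → Submodule k M) : WithBot (WithTop ℤ) :=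
  sSup {r | ∃ (i : ℕ) (j : ℤ), betti (n := n) 𝓜 i j ≠ 0 ∧
    r = (((j - i : ℤ) : WithTop ℤ) : WithBot (WithTop ℤ))}

/-- The projective dimension `pd M = max {i : β_{i,j}(M) ≠ 0 for some j}`, as a supremum in
`ℕ ∪ {±∞}` (it is `-∞` for `M = 0`). -/
def pd (𝓜 : ℤ → Submodule k M) : WithBot ℕ∞ :=
  sSup {p | ∃ (i : ℕ) (j : ℤ), betti (n := n) 𝓜 i j ≠ 0 ∧ p = ((i : ℕ∞) : WithBot ℕ∞)}

end Invariants

section Maps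

variable {n : ℕ} {k : Type u} [Field k]

/-- The map `R/(I:f) → R/I` induced by multiplication by `f`. -/
def mulMap (I : Ideal (Poly n k)) (f : Poly n k) :
    (Poly n k ⧸ I.colon {f}) →ₗ[Poly n k] (Poly n k ⧸ I) :=
  Submodule.mapQ (I.colon {f}) I (LinearMap.mulRight (Poly n k) f) fun g hg => by
    simpa [Submodule.mem_colon_singleton] using hg

/-- The canonical projection `R/I → R/(I + (f))`. -/
def projMap (I : Ideal (Poly n k)) (f : Poly n k) :
    (Poly n k ⧸ I) →ₗ[Poly n k] (Poly n k ⧸ (I ⊔ Ideal.span {f})) :=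
  Submodule.factor le_sup_left

end Maps

end GradedResolution

end

open GradedResolution

/-! The sequence is exact because `g * f ∈ I` means `g ∈ (I : f)`, and the cone of any lift `ψ` of
an injection `N → M` between resolutions resolves the cokernel. Minimality of the cone is the real
content: its differential consists of those of `F` and `G`, up to sign, together with `ψ`, so `ψ`
must vanish modulo `𝔪`.

Since `(I : f) = (I : h₁)`, multiplication by `h₁` is defined on `R/(I : f)`, and multiplication by
`f` is `h₂` times it. If `χ` lifts the former, then `h₂ • χ` lifts the latter and has entries in
`𝔪`. Any other lift differs from it by a map homotopic to zero, `F.d ∘ s + s ∘ G.d`, which lands in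
`𝔪 F` because both resolutions are minimal (`apply_mem_of_lift_zero`, `lift_apply_mem`).

For (a)-(c), `betti` is defined through a chosen resolution, so two further facts are needed:
minimal resolutions exist (`exists_isMinimalResolution`) and their ranks agree (`rank_le`,
`betti_eq`). The ranks of the cone then give (a), and (b) and (c) follow by taking suprema. -/

noncomputable section

namespace GradedResolution

universe u v w

/-! ### Constant terms, `𝔪`, and the `ℤ`-grading of the polynomial ring. -/

section Polynomials

variable {n : ℕ} {k : Type u} [Field k]

theorem mem_maxIdeal_iff {p : Poly n k} : p ∈ maxIdeal n k ↔ constantCoeff p = 0 := by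
  rw [maxIdeal, ← Set.image_univ, mem_ideal_span_X_image]
  constructor
  · intro h
    by_contra hp
    obtain ⟨i, -, hi⟩ := h 0 (mem_support_iff.2 hp)
    exact hi rfl
  · intro h m hm
    by_contra! hi
    have hm0 : m = 0 := Finsupp.ext fun i => hi i (Set.mem_univ i)
    rw [mem_support_iff, hm0] at hm
    exact hm h

/-- Turns minimality into a condition on constant terms of coordinates, that is, into linear algebra
over `k`. -/
theorem mem_maxIdeal_smul_top_iff {ι : Type} {x : ι →₀ Poly n k} :
    x ∈ maxIdeal n k • (⊤ : Submodule (Poly n k) (ι →₀ Poly n k)) ↔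
      ∀ b, constantCoeff (x b) = 0 := by
  constructor
  · intro h b
    rw [← mem_maxIdeal_iff]
    refine Submodule.smul_induction_on h (fun r hr y _ => ?_) fun y z hy hz => ?_
    · exact Ideal.mul_mem_right _ _ hr
    · exact Ideal.add_mem _ hy hz
  · intro h
    rw [← Finsupp.sum_single x]
    refine Submodule.sum_mem _ fun b _ => ?_
    have : Finsupp.single b (x b) = x b • Finsupp.single b (1 : Poly n k) := by simp
    rw [this]
    exact Submodule.smul_mem_smul (mem_maxIdeal_iff.2 (h b)) trivial

theorem map_mem_maxIdeal_smul_top {M : Type v} {N : Type w} [AddCommGroup M] [AddCommGroup N]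
    [Module (Poly n k) M] [Module (Poly n k) N] (φ : M →ₗ[Poly n k] N) {x : M}
    (hx : x ∈ maxIdeal n k • (⊤ : Submodule (Poly n k) M)) :
    φ x ∈ maxIdeal n k • (⊤ : Submodule (Poly n k) N) :=
  Submodule.smul_mono le_rfl le_top
    (Submodule.map_smul'' (maxIdeal n k) ⊤ φ ▸ Submodule.mem_map_of_mem hx)

theorem mem_polyGrading_natCast {m : ℕ} {p : Poly n k} :
    p ∈ polyGrading n k m ↔ p.IsHomogeneous m := by
  simp [polyGrading]

theorem mem_polyGrading_cases {j : ℤ} {p : Poly n k} (hp : p ∈ polyGrading n k j) :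
    p = 0 ∨ ∃ m : ℕ, j = m ∧ p.IsHomogeneous m := by
  rcases lt_or_ge j 0 with hj | hj
  · left
    simpa [polyGrading, not_le.2 hj] using hp
  · lift j to ℕ using hj
    exact Or.inr ⟨j, rfl, mem_polyGrading_natCast.1 hp⟩

theorem mul_mem_polyGrading {i j : ℤ} {p q : Poly n k} (hp : p ∈ polyGrading n k i)
    (hq : q ∈ polyGrading n k j) : p * q ∈ polyGrading n k (i + j) := by
  rcases mem_polyGrading_cases hp with rfl | ⟨a, rfl, ha⟩
  · simp
  rcases mem_polyGrading_cases hq with rfl | ⟨b, rfl, hb⟩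
  · simp
  rw [← Nat.cast_add, mem_polyGrading_natCast]
  exact ha.mul hb

theorem one_mem_polyGrading : (1 : Poly n k) ∈ polyGrading n k 0 := by
  rw [← Nat.cast_zero, mem_polyGrading_natCast]
  exact isHomogeneous_one _ _

theorem constantCoeff_eq_zero_of_mem_polyGrading {j : ℤ} {p : Poly n k}
    (hp : p ∈ polyGrading n k j) (hj : j ≠ 0) : constantCoeff p = 0 := by
  rcases mem_polyGrading_cases hp with rfl | ⟨a, rfl, ha⟩
  · simp
  · exact ha.coeff_eq_zero (by simpa using fun h : 0 = a => hj (by simp [← h]))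

/-- The homogeneous component of degree `j` of a polynomial, zero for `j < 0`. -/
def polyComponent (n : ℕ) (k : Type u) [Field k] (j : ℤ) : Poly n k →ₗ[k] Poly n k :=
  if 0 ≤ j then homogeneousComponent j.toNat else 0

theorem polyComponent_natCast (m : ℕ) :
    polyComponent n k m = homogeneousComponent m := by
  simp [polyComponent]

theorem polyComponent_neg {j : ℤ} (hj : j < 0) : polyComponent n k j = 0 := by
  simp [polyComponent, not_le.2 hj]

end Polynomials

/-! ### Homogeneous components, and graded lifting out of free modules. -/

section Components

variable {n : ℕ} {k : Type u} [Field k]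

/-- `c` is a family of projections onto the graded pieces `𝓜 j`. -/
structure IsComponents {M : Type v} [AddCommGroup M] [Module k M] (𝓜 : ℤ → Submodule k M)
    (c : ℤ → M →ₗ[k] M) : Prop where
  mem : ∀ j x, c j x ∈ 𝓜 j
  eq_self : ∀ j, ∀ x ∈ 𝓜 j, c j x = x
  eq_zero : ∀ i j, i ≠ j → ∀ x ∈ 𝓜 i, c j x = 0

theorem isComponents_poly : IsComponents (polyGrading n k) (polyComponent n k) where
  mem j x := by
    rcases lt_or_ge j 0 with hj | hj
    · simp [polyComponent_neg hj]
    · lift j to ℕ using hj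
      rw [polyComponent_natCast, mem_polyGrading_natCast]
      exact homogeneousComponent_isHomogeneous _ _
  eq_self j x hx := by
    rcases mem_polyGrading_cases hx with rfl | ⟨a, rfl, ha⟩
    · simp
    · rw [polyComponent_natCast, homogeneousComponent_eq_self ha]
  eq_zero i j hij x hx := by
    rcases mem_polyGrading_cases hx with rfl | ⟨a, rfl, ha⟩
    · simp
    rcases lt_or_ge j 0 with hj | hj
    · simp [polyComponent_neg hj]
    · lift j to ℕ using hj
      rw [polyComponent_natCast, homogeneousComponent_of_mem (n := a) ha, if_neg]
      exact fun h => hij (by rw [h])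

/-- The homogeneous component of degree `j` in a graded free module. -/
def freeComponent {ι : Type} (deg : ι → ℤ) (j : ℤ) :
    (ι →₀ Poly n k) →ₗ[k] (ι →₀ Poly n k) where
  toFun x := Finsupp.onFinset x.support (fun b => polyComponent n k (j - deg b) (x b))
    fun b hb => by
    rw [Finsupp.mem_support_iff]
    intro h
    exact hb (by rw [h, map_zero])
  map_add' x y := by ext1 b; simp
  map_smul' c x := by ext1 b; simp

@[simp]
theorem freeComponent_apply {ι : Type} (deg : ι → ℤ) (j : ℤ) (x : ι →₀ Poly n k) (b : ι) :
    freeComponent deg j x b = polyComponent n k (j - deg b) (x b) := rfl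

theorem isComponents_free {ι : Type} (deg : ι → ℤ) :
    IsComponents (freeGrading (n := n) (k := k) deg) (freeComponent deg) where
  mem j x b := isComponents_poly.mem _ _
  eq_self j x hx := Finsupp.ext fun b => isComponents_poly.eq_self _ _ (hx b)
  eq_zero i j hij x hx := Finsupp.ext fun b =>
    isComponents_poly.eq_zero _ _ (fun h => hij (by linarith)) _ (hx b)

theorem iSup_polyGrading : ⨆ j, polyGrading n k j = ⊤ := by
  refine eq_top_iff.2 fun x _ => ?_
  rw [← sum_homogeneousComponent x]
  refine Submodule.sum_mem _ fun i _ => Submodule.mem_iSup_of_mem (i : ℤ) ?_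
  exact mem_polyGrading_natCast.2 (homogeneousComponent_isHomogeneous _ _)

theorem single_mem_freeGrading {ι : Type} {deg : ι → ℤ} {j : ℤ} {b : ι} {p : Poly n k}
    (hp : p ∈ polyGrading n k (j - deg b)) : Finsupp.single b p ∈ freeGrading deg j := by
  classical
  intro b'
  rw [Finsupp.single_apply]
  split_ifs with h
  · rwa [← h]
  · exact Submodule.zero_mem _

theorem iSup_freeGrading {ι : Type} (deg : ι → ℤ) :
    ⨆ j, freeGrading (n := n) (k := k) deg j = ⊤ := by
  refine eq_top_iff.2 fun x _ => ?_
  induction x using Finsupp.induction_linear with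
  | zero => exact Submodule.zero_mem _
  | add x y hx hy => exact Submodule.add_mem _ (hx trivial) (hy trivial)
  | single b p =>
    have hp : p ∈ ⨆ j, polyGrading n k j := by rw [iSup_polyGrading]; trivial
    clear * - hp
    induction hp using Submodule.iSup_induction' with
    | mem j p hp =>
      refine Submodule.mem_iSup_of_mem (j + deg b) (single_mem_freeGrading ?_)
      rwa [add_sub_cancel_right]
    | zero => simp
    | add p q _ _ hp hq =>
      rw [Finsupp.single_add]
      exact Submodule.add_mem _ hp hq

/-- A graded map commutes with taking homogeneous components. -/
theorem IsGradedMap.map_component {M : Type v} {N : Type w} [AddCommGroup M] [AddCommGroup N]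
    [Module k M] [Module k N] [Module (Poly n k) M] [Module (Poly n k) N]
    {𝓜 : ℤ → Submodule k M} {𝓝 : ℤ → Submodule k N} {c : ℤ → M →ₗ[k] M} {e : ℤ → N →ₗ[k] N}
    {φ : M →ₗ[Poly n k] N} (hφ : IsGradedMap 𝓜 𝓝 φ) (hc : IsComponents 𝓜 c)
    (he : IsComponents 𝓝 e) (htop : ⨆ j, 𝓜 j = ⊤) (j : ℤ) (x : M) : φ (c j x) = e j (φ x) := by
  have hx : x ∈ ⨆ j, 𝓜 j := by rw [htop]; trivial
  induction hx using Submodule.iSup_induction' with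
  | mem i x hx =>
    by_cases hij : i = j
    · subst hij
      rw [hc.eq_self _ _ hx, he.eq_self _ _ (hφ _ _ hx)]
    · rw [hc.eq_zero _ _ hij _ hx, he.eq_zero _ _ hij _ (hφ _ _ hx), map_zero]
  | zero => simp
  | add x y _ _ hx hy => simp [hx, hy]

/-- A homogeneous element in the range of a graded map has a homogeneous preimage. -/
theorem IsGradedMap.exists_preimage {N : Type w} [AddCommGroup N]
    [Module k N] [Module (Poly n k) N] {ι : Type} {deg : ι → ℤ}
    {𝓝 : ℤ → Submodule k N} {e : ℤ → N →ₗ[k] N}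
    {φ : (ι →₀ Poly n k) →ₗ[Poly n k] N} (hφ : IsGradedMap (freeGrading deg) 𝓝 φ)
    (he : IsComponents 𝓝 e) {j : ℤ} {y : N} (hy : y ∈ 𝓝 j) (hy' : y ∈ LinearMap.range φ) :
    ∃ x ∈ freeGrading deg j, φ x = y := by
  obtain ⟨x, rfl⟩ := hy'
  refine ⟨freeComponent deg j x, (isComponents_free deg).mem _ _, ?_⟩
  rw [hφ.map_component (isComponents_free deg) he (iSup_freeGrading deg), he.eq_self _ _ hy]

/-- A linear map out of a graded free module is graded if it preserves the degrees of the basis. -/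
theorem isGradedMap_linearCombination {ι κ : Type} {deg : ι → ℤ} {deg' : κ → ℤ}
    {v : κ → ι →₀ Poly n k} (hv : ∀ b, v b ∈ freeGrading deg (deg' b)) :
    IsGradedMap (freeGrading deg') (freeGrading deg) (Finsupp.linearCombination (Poly n k) v) := by
  intro j x hx
  rw [Finsupp.linearCombination_apply]
  refine Submodule.sum_mem _ fun b _ a => ?_
  have := mul_mem_polyGrading (hx b) (hv b a)
  rwa [sub_add_sub_cancel] at this

/-- A graded map out of a graded free module lifts through any graded map from a graded free
module whose range contains its range. -/
theorem IsGradedMap.exists_lift {N : Type w} [AddCommGroup N]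
    [Module k N] [Module (Poly n k) N] {ι κ : Type} {deg : ι → ℤ} {deg' : κ → ℤ}
    {𝓝 : ℤ → Submodule k N} {e : ℤ → N →ₗ[k] N}
    {φ : (ι →₀ Poly n k) →ₗ[Poly n k] N} {g : (κ →₀ Poly n k) →ₗ[Poly n k] N}
    (hφ : IsGradedMap (freeGrading deg) 𝓝 φ) (hg : IsGradedMap (freeGrading deg') 𝓝 g)
    (he : IsComponents 𝓝 e) (hgφ : ∀ x, g x ∈ LinearMap.range φ) :
    ∃ s : (κ →₀ Poly n k) →ₗ[Poly n k] (ι →₀ Poly n k),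
      IsGradedMap (freeGrading deg') (freeGrading deg) s ∧ φ ∘ₗ s = g := by
  have key : ∀ b : κ, ∃ x ∈ freeGrading deg (deg' b), φ x = g (Finsupp.single b 1) := fun b =>
    hφ.exists_preimage he
      (hg _ _ (single_mem_freeGrading (by rw [sub_self]; exact one_mem_polyGrading))) (hgφ _)
  choose v hv hv' using key
  refine ⟨Finsupp.linearCombination (Poly n k) v, isGradedMap_linearCombination hv, ?_⟩
  refine Finsupp.lhom_ext' fun b => LinearMap.ext_ring ?_
  simp [hv']

/-- A linear map out of a free module lifts through any map whose range contains its range. -/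
theorem exists_lift_of_mem_range {M : Type v} {N : Type w} [AddCommGroup M] [AddCommGroup N]
    [Module (Poly n k) M] [Module (Poly n k) N] {κ : Type}
    (φ : M →ₗ[Poly n k] N) (g : (κ →₀ Poly n k) →ₗ[Poly n k] N)
    (hgφ : ∀ x, g x ∈ LinearMap.range φ) :
    ∃ s : (κ →₀ Poly n k) →ₗ[Poly n k] M, φ ∘ₗ s = g := by
  choose v hv using fun b : κ => hgφ (Finsupp.single b 1)
  refine ⟨Finsupp.linearCombination (Poly n k) v, ?_⟩
  refine Finsupp.lhom_ext' fun b => LinearMap.ext_ring ?_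
  simp [hv]

end Components

/-! ### Gradings on quotients by homogeneous ideals. -/

section Quotients

variable {n : ℕ} {k : Type u} [Field k] {J : Ideal (Poly n k)}

theorem polyComponent_mem (hJ : J.IsHomogeneous (homogeneousSubmodule (Fin n) k)) (j : ℤ)
    {p : Poly n k} (hp : p ∈ J) : polyComponent n k j p ∈ J := by
  rcases lt_or_ge j 0 with hj | hj
  · simp [polyComponent_neg hj]
  · lift j to ℕ using hj
    rw [polyComponent_natCast]
    exact (mem_iff_homogeneousComponent_mem hJ p).1 hp j

/-- A homogeneous ideal is stable under taking components, so the projections of the polynomial ring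
descend. -/
theorem exists_isComponents_quot (hJ : J.IsHomogeneous (homogeneousSubmodule (Fin n) k)) :
    ∃ c, IsComponents (quotGrading J) c := by
  refine ⟨fun j => (J.restrictScalars k).mapQ (J.restrictScalars k) (polyComponent n k j)
    fun p hp => polyComponent_mem hJ j hp, ?_, ?_, ?_⟩
  · intro j x
    obtain ⟨p, rfl⟩ := Submodule.Quotient.mk_surjective _ x
    exact ⟨_, isComponents_poly.mem j p, rfl⟩
  · rintro j _ ⟨p, hp, rfl⟩
    exact congrArg (Submodule.Quotient.mk (p := J)) (isComponents_poly.eq_self j p hp)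
  · rintro i j hij _ ⟨p, hp, rfl⟩
    exact congrArg (Submodule.Quotient.mk (p := J)) (isComponents_poly.eq_zero i j hij p hp)

/-- The degree `0` component of an element of `J` is again in `J`; a nonzero constant there would be
a unit. -/
theorem le_maxIdeal_of_isHomogeneous (hJ : J.IsHomogeneous (homogeneousSubmodule (Fin n) k))
    (hJ' : J ≠ ⊤) : J ≤ maxIdeal n k := by
  intro p hp
  rw [mem_maxIdeal_iff]
  by_contra h
  have h0 := (mem_iff_homogeneousComponent_mem hJ p).1 hp 0
  rw [homogeneousComponent_zero] at h0
  exact hJ' (Ideal.eq_top_of_isUnit_mem _ h0 ((isUnit_iff_ne_zero.2 h).map C))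

/-- As `f` is homogeneous of degree `d`, the component of `g * f` in degree `i + d` is the degree
`i` component of `g` times `f`. -/
theorem isHomogeneous_colon (hJ : J.IsHomogeneous (homogeneousSubmodule (Fin n) k))
    {f : Poly n k} {d : ℕ} (hf : f.IsHomogeneous d) :
    (J.colon {f}).IsHomogeneous (homogeneousSubmodule (Fin n) k) := by
  intro i g hg
  rw [Submodule.mem_colon_singleton, smul_eq_mul] at hg ⊢
  have h := (Ideal.IsHomogeneous.mem_iff _ hJ).1 hg (i + d)
  rwa [DirectSum.coe_decompose_mul_add_of_right_mem (homogeneousSubmodule (Fin n) k) hf] at h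

theorem isHomogeneous_sup_span (hJ : J.IsHomogeneous (homogeneousSubmodule (Fin n) k))
    {f : Poly n k} {d : ℕ} (hf : f.IsHomogeneous d) :
    (J ⊔ Ideal.span {f}).IsHomogeneous (homogeneousSubmodule (Fin n) k) := by
  refine Ideal.IsHomogeneous.sup hJ (Ideal.homogeneous_span _ _ ?_)
  rintro _ rfl
  exact ⟨d, hf⟩

end Quotients

/-! ### Minimal homogeneous generators of graded submodules. -/

section MinimalGenerators

variable {n : ℕ} {k : Type u} [Field k] {ι : Type} {deg : ι → ℤ}
  {K : Submodule (Poly n k) (ι →₀ Poly n k)}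

/-- A finitely generated submodule stable under homogeneous components is generated by finitely
many homogeneous elements. -/
theorem exists_homogeneous_generators [Finite ι] (hK : ∀ j, ∀ x ∈ K, freeComponent deg j x ∈ K) :
    ∃ (r : ℕ) (deg' : Fin r → ℤ) (v : Fin r → ι →₀ Poly n k),
      (∀ b, v b ∈ freeGrading deg (deg' b)) ∧ Submodule.span (Poly n k) (Set.range v) = K := by
  classical
  obtain ⟨S, hS⟩ : K.FG := IsNoetherian.noetherian K
  -- Each generator is replaced by its finitely many homogeneous components, every one stored with
  -- its degree.
  have key : ∀ x : ι →₀ Poly n k, x ∈ K → ∃ T : Finset (ℤ × (ι →₀ Poly n k)),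
      (∀ t ∈ T, t.2 ∈ freeGrading deg t.1 ∧ t.2 ∈ K) ∧
        x ∈ Submodule.span (Poly n k) (Prod.snd '' (T : Set (ℤ × (ι →₀ Poly n k)))) := by
    intro x hx
    have hx' : x ∈ ⨆ j, freeGrading (n := n) (k := k) deg j := by
      rw [iSup_freeGrading]; trivial
    obtain ⟨g, hg, hgx⟩ := (Submodule.mem_iSup_iff_exists_finsupp _ _).1 hx'
    have hgc : ∀ j, freeComponent deg j x = g j := by
      intro j
      rw [← hgx, Finsupp.sum, map_sum, Finset.sum_eq_single j]
      · exact (isComponents_free deg).eq_self _ _ (hg j)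
      · intro i _ hij
        exact (isComponents_free deg).eq_zero _ _ hij _ (hg i)
      · intro hj
        rw [Finsupp.notMem_support_iff.1 hj, map_zero]
    refine ⟨g.support.image fun j => (j, g j), ?_, ?_⟩
    · intro t ht
      obtain ⟨j, -, rfl⟩ := Finset.mem_image.1 ht
      exact ⟨hg j, hgc j ▸ hK j x hx⟩
    · rw [← hgx]
      refine Submodule.sum_mem _ fun j hj => Submodule.subset_span ⟨(j, g j), ?_, rfl⟩
      exact Finset.mem_coe.2 (Finset.mem_image_of_mem _ hj)
  choose T hT hxT using key
  have hSK : ∀ x ∈ S, x ∈ K := fun x hx => hS ▸ Submodule.subset_span hx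
  let U : Finset (ℤ × (ι →₀ Poly n k)) := S.attach.biUnion fun x => T x.1 (hSK _ x.2)
  refine ⟨U.card, fun b => (U.equivFin.symm b).1.1, fun b => (U.equivFin.symm b).1.2, ?_, ?_⟩
  · intro b
    obtain ⟨x, -, hx⟩ := Finset.mem_biUnion.1 (U.equivFin.symm b).2
    exact (hT _ _ _ hx).1
  · refine le_antisymm (Submodule.span_le.2 ?_) ?_
    · rintro _ ⟨b, rfl⟩
      obtain ⟨x, -, hx⟩ := Finset.mem_biUnion.1 (U.equivFin.symm b).2
      exact (hT _ _ _ hx).2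
    · rw [← hS, Submodule.span_le]
      intro x hx
      refine Submodule.span_mono ?_ (hxT x (hSK x hx))
      rintro _ ⟨t, ht, rfl⟩
      have htU : t ∈ U := Finset.mem_biUnion.2 ⟨⟨x, hx⟩, Finset.mem_attach _ _, ht⟩
      exact ⟨U.equivFin ⟨t, htU⟩, by simp⟩

/-- A finitely generated submodule stable under homogeneous components has a minimal system of
homogeneous generators: all relations between them have coefficients in `𝔪`. -/
theorem exists_minimal_generators [Finite ι] (hK : ∀ j, ∀ x ∈ K, freeComponent deg j x ∈ K) :
    ∃ (κ : Type) (_ : Finite κ) (deg' : κ → ℤ) (φ : (κ →₀ Poly n k) →ₗ[Poly n k] (ι →₀ Poly n k)),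
      IsGradedMap (freeGrading deg') (freeGrading deg) φ ∧ LinearMap.range φ = K ∧
        LinearMap.ker φ ≤ maxIdeal n k • (⊤ : Submodule (Poly n k) (κ →₀ Poly n k)) := by
  classical
  -- The least possible number `r` of homogeneous generators is used; a relation with a coefficient
  -- outside `𝔪` will make one of them redundant.
  have hex := exists_homogeneous_generators hK
  obtain ⟨deg', v, hv, hvK⟩ := Nat.find_spec hex
  have hmin := fun m (hm : m < Nat.find hex) => Nat.find_min hex hm
  generalize Nat.find hex = r at deg' v hmin
  refine ⟨Fin r, inferInstance, deg', Finsupp.linearCombination (Poly n k) v,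
    isGradedMap_linearCombination hv, by rw [Finsupp.range_linearCombination, hvK], ?_⟩
  intro x hx
  rw [LinearMap.mem_ker] at hx
  rw [mem_maxIdeal_smul_top_iff]
  by_contra! hb
  obtain ⟨b, hb⟩ := hb
  -- The component of the relation in degree `deg' b` is still a relation, and its coefficient at
  -- `b` is exactly the nonzero constant term of `x b`. Dividing by it expresses `v b` through the
  -- other generators.
  set y := freeComponent deg' (deg' b) x with hy
  have hyx : Finsupp.linearCombination (Poly n k) v y = 0 := by
    rw [hy, (isGradedMap_linearCombination hv).map_component (isComponents_free deg')
      (isComponents_free deg) (iSup_freeGrading deg'), hx, map_zero]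
  have hyb : y b = C (constantCoeff (x b)) := by
    rw [hy, freeComponent_apply, sub_self, ← Nat.cast_zero, polyComponent_natCast,
      homogeneousComponent_zero]
    rfl
  have hvb : v b ∈ Submodule.span (Poly n k) (v '' {b}ᶜ) := by
    rw [Finsupp.linearCombination_apply, Finsupp.sum_fintype _ _ (by simp),
      ← Finset.add_sum_erase _ _ (Finset.mem_univ b), hyb,
      add_eq_zero_iff_eq_neg] at hyx
    have h1 : v b =
        (C (constantCoeff (x b))⁻¹ : Poly n k) • (C (constantCoeff (x b)) : Poly n k) • v b := by
      rw [smul_smul, ← C_mul, inv_mul_cancel₀ hb, C_1, one_smul]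
    rw [h1, hyx]
    refine Submodule.smul_mem _ _ (Submodule.neg_mem _ (Submodule.sum_mem _ fun a ha => ?_))
    exact Submodule.smul_mem _ _
      (Submodule.subset_span ⟨a, Finset.ne_of_mem_erase ha, rfl⟩)
  have hr : 0 < r := b.pos
  refine hmin (r - 1) (by omega) ?_
  obtain ⟨s, rfl⟩ : ∃ s, r = s + 1 := ⟨r - 1, by omega⟩
  refine ⟨fun a => deg' (b.succAbove a), fun a => v (b.succAbove a), fun a => hv _, ?_⟩
  rw [← hvK]
  refine le_antisymm (Submodule.span_mono ?_) (Submodule.span_le.2 ?_)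
  · rintro _ ⟨a, rfl⟩
    exact ⟨_, rfl⟩
  · have himg : v '' {b}ᶜ = Set.range fun a => v (b.succAbove a) := by
      rw [← Fin.range_succAbove, ← Set.range_comp]
      rfl
    rw [himg] at hvb
    rintro _ ⟨a, rfl⟩
    rcases eq_or_ne a b with rfl | hab
    · exact hvb
    · obtain ⟨c, rfl⟩ := Fin.exists_succAbove_eq hab
      exact Submodule.subset_span ⟨c, rfl⟩

end MinimalGenerators

/-! ### Existence of minimal graded free resolutions. -/

section Existence

variable {n : ℕ} {k : Type u} [Field k]

/-- A graded map between finitely generated graded free modules. -/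
structure FreeMap (n : ℕ) (k : Type u) [Field k] where
  source : Type
  target : Type
  finite : Finite target
  finite_source : Finite source
  degSource : source → ℤ
  degTarget : target → ℤ
  map : (source →₀ Poly n k) →ₗ[Poly n k] (target →₀ Poly n k)
  graded : IsGradedMap (freeGrading degSource) (freeGrading degTarget) map

theorem FreeMap.exists_next (S : FreeMap n k) :
    ∃ (κ : Type) (_ : Finite κ) (deg' : κ → ℤ)
      (φ : (κ →₀ Poly n k) →ₗ[Poly n k] (S.source →₀ Poly n k)),
      IsGradedMap (freeGrading deg') (freeGrading S.degSource) φ ∧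
        LinearMap.range φ = LinearMap.ker S.map ∧
        LinearMap.ker φ ≤ maxIdeal n k • (⊤ : Submodule (Poly n k) (κ →₀ Poly n k)) := by
  have := S.finite_source
  refine exists_minimal_generators fun j x hx => ?_
  rw [LinearMap.mem_ker] at hx ⊢
  rw [S.graded.map_component (isComponents_free _) (isComponents_free _) (iSup_freeGrading _), hx,
    map_zero]

/-- A minimal graded presentation of the kernel of a graded map. -/
def FreeMap.next (S : FreeMap n k) : FreeMap n k where
  source := S.exists_next.choose
  target := S.source
  finite := S.finite_source
  finite_source := S.exists_next.choose_spec.choose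
  degSource := S.exists_next.choose_spec.choose_spec.choose
  degTarget := S.degSource
  map := S.exists_next.choose_spec.choose_spec.choose_spec.choose
  graded := S.exists_next.choose_spec.choose_spec.choose_spec.choose_spec.1

theorem FreeMap.range_next (S : FreeMap n k) :
    LinearMap.range S.next.map = LinearMap.ker S.map :=
  S.exists_next.choose_spec.choose_spec.choose_spec.choose_spec.2.1

theorem FreeMap.ker_next (S : FreeMap n k) : LinearMap.ker S.next.map ≤
    maxIdeal n k • (⊤ : Submodule (Poly n k) (S.next.source →₀ Poly n k)) :=
  S.exists_next.choose_spec.choose_spec.choose_spec.choose_spec.2.2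

/-- The iterated minimal presentations of kernels, starting with a given graded map. -/
def FreeMap.iter (S : FreeMap n k) : ℕ → FreeMap n k
  | 0 => S
  | i + 1 => (S.iter i).next

/-- The complex of iterated minimal presentations of kernels. -/
def FreeMap.complex (S : FreeMap n k) : FreeComplex n k where
  ι i := (S.iter i).target
  finite i := (S.iter i).finite
  deg i := (S.iter i).degTarget
  -- The source of `S.iter i` is by definition the target of `S.iter (i + 1)`, so consecutive maps
  -- compose.
  d i := (S.iter i).map
  d_graded i := (S.iter i).graded
  d_comp_d i := LinearMap.range_le_ker_iff.1 (S.iter i).range_next.le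

/-- Take `F_0 = R` with its generator in degree `0` and iterate minimal presentations of kernels.
The image of `d 0` is `J`, contained in `𝔪` because `J` is proper; every later image is the kernel
of a minimal presentation, hence lies in `𝔪` times the free module. -/
theorem exists_isMinimalResolution {J : Ideal (Poly n k)}
    (hJ : J.IsHomogeneous (homogeneousSubmodule (Fin n) k)) (hJ' : J ≠ ⊤) :
    ∃ (F : FreeComplex n k) (ε : F.mod 0 →ₗ[Poly n k] (Poly n k ⧸ J)),
      F.IsMinimalResolution (quotGrading J) ε := by
  let ε : (Unit →₀ Poly n k) →ₗ[Poly n k] (Poly n k ⧸ J) := J.mkQ ∘ₗ Finsupp.lapply ()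
  have hε : ∀ x, ε x = Submodule.Quotient.mk (x ()) := fun _ => rfl
  have hker : ∀ x, x ∈ LinearMap.ker ε ↔ x () ∈ J := fun x => by
    rw [LinearMap.mem_ker, hε, Submodule.Quotient.mk_eq_zero]
  obtain ⟨κ, hκ, deg', φ, hφ, hrange, hmin⟩ :=
    exists_minimal_generators (deg := fun _ : Unit => (0 : ℤ)) (K := LinearMap.ker ε)
      fun j x hx => by
        rw [hker] at hx ⊢
        exact polyComponent_mem hJ _ hx
  let S : FreeMap n k := ⟨κ, Unit, inferInstance, hκ, deg', fun _ => 0, φ, hφ⟩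
  have hmin' : ∀ i, LinearMap.ker (S.iter i).map ≤
      maxIdeal n k • (⊤ : Submodule (Poly n k) ((S.iter i).source →₀ Poly n k)) := by
    rintro (_ | i)
    · exact hmin
    · exact FreeMap.ker_next _
  have hgraded : IsGradedMap (freeGrading fun _ : Unit => (0 : ℤ)) (quotGrading J) ε := by
    intro j x hx
    have hx0 := hx ()
    rw [sub_zero] at hx0
    exact ⟨x (), hx0, rfl⟩
  have hsurj : Function.Surjective ε := by
    intro y
    obtain ⟨p, rfl⟩ := Submodule.Quotient.mk_surjective _ y
    exact ⟨Finsupp.single () p, by rw [hε, Finsupp.single_eq_same]⟩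
  have hmin₀ : LinearMap.ker ε ≤
      maxIdeal n k • (⊤ : Submodule (Poly n k) (Unit →₀ Poly n k)) := by
    intro x hx
    rw [mem_maxIdeal_smul_top_iff]
    intro b
    exact mem_maxIdeal_iff.1 (le_maxIdeal_of_isHomogeneous hJ hJ' ((hker x).1 hx))
  refine ⟨S.complex, ε, ⟨hgraded, hsurj, LinearMap.exact_iff.2 hrange.symm, fun i =>
    LinearMap.exact_iff.2 (FreeMap.range_next _).symm⟩, ?_⟩
  rintro (_ | i)
  · exact hrange.le.trans hmin₀
  · exact (FreeMap.range_next _).le.trans (hmin' i)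

end Existence

/-! ### Comparison of resolutions and uniqueness of the graded Betti numbers. -/

namespace FreeComplex

variable {n : ℕ} {k : Type u} [Field k] {F G : FreeComplex n k} {M : Type v} [AddCommGroup M]
  [Module k M] [Module (Poly n k) M] {𝓜 : ℤ → Submodule k M} {c : ℤ → M →ₗ[k] M}
  {εF : F.mod 0 →ₗ[Poly n k] M}

theorem IsResolution.comp_d_zero (hF : F.IsResolution 𝓜 εF) : εF ∘ₗ F.d 0 = 0 :=
  hF.exact_zero.linearMap_comp_eq_zero

/-- Comparison theorem: a graded map from the augmented module of a complex of graded free modules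
lifts to a graded chain map into a graded resolution. -/
theorem IsResolution.exists_hom (hF : F.IsResolution 𝓜 εF) (hc : IsComponents 𝓜 c)
    (g : G.mod 0 →ₗ[Poly n k] M) (hg : IsGradedMap (G.grading 0) 𝓜 g) (hgd : g ∘ₗ G.d 0 = 0) :
    ∃ ψ : Hom G F, εF ∘ₗ ψ.f 0 = g := by
  -- A stage holds two consecutive components with their commuting square: this is what the
  -- construction of the next component needs, and overlapping stages glue to a chain map.
  let Step : ℕ → Type u := fun i =>
    {p : (G.mod i →ₗ[Poly n k] F.mod i) × (G.mod (i + 1) →ₗ[Poly n k] F.mod (i + 1)) //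
      IsGradedMap (G.grading i) (F.grading i) p.1 ∧
      IsGradedMap (G.grading (i + 1)) (F.grading (i + 1)) p.2 ∧ F.d i ∘ₗ p.2 = p.1 ∘ₗ G.d i}
  obtain ⟨f₀, hf₀, hf₀g⟩ := IsGradedMap.exists_lift hF.graded hg hc fun x => hF.surjective (g x)
  obtain ⟨f₁, hf₁, hf₁d⟩ := IsGradedMap.exists_lift (F.d_graded 0)
    (g := f₀ ∘ₗ G.d 0) (fun j x hx => hf₀ j _ (G.d_graded 0 j x hx)) (isComponents_free _)
    fun x => (hF.exact_zero _).1 <| by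
      rw [← LinearMap.comp_apply, ← LinearMap.comp_assoc, hf₀g, hgd, LinearMap.zero_apply]
  have next : ∀ i (s : Step i), ∃ t : Step (i + 1), t.1.1 = s.1.2 := by
    rintro i ⟨⟨a, b⟩, ha, hb, hab⟩
    obtain ⟨b', hb', hb'd⟩ := IsGradedMap.exists_lift (F.d_graded (i + 1))
      (g := b ∘ₗ G.d (i + 1)) (fun j x hx => hb j _ (G.d_graded (i + 1) j x hx))
      (isComponents_free _) fun x => (hF.exact_succ i _).1 <| by
        rw [← LinearMap.comp_apply, ← LinearMap.comp_assoc, hab, LinearMap.comp_assoc, G.d_comp_d,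
          LinearMap.comp_zero, LinearMap.zero_apply]
    exact ⟨⟨(b, b'), hb, hb', hb'd⟩, rfl⟩
  choose nxt hnxt using next
  let seq : ∀ i, Step i := fun i => Nat.rec ⟨(f₀, f₁), hf₀, hf₁, hf₁d⟩ nxt i
  have hseq : ∀ i, (seq (i + 1)).1.1 = (seq i).1.2 := fun i => hnxt i (seq i)
  exact ⟨⟨fun i => (seq i).1.1, fun i => (seq i).2.1, fun i => by
    rw [hseq]; exact (seq i).2.2.2⟩, hf₀g⟩

/-- A chain map lifting zero between minimal complexes, the target a resolution, is zero
modulo `𝔪`. -/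
theorem IsMinimalResolution.apply_mem_of_lift_zero (hF : F.IsMinimalResolution 𝓜 εF)
    (hG : G.IsMinimal) (D : ∀ i, G.mod i →ₗ[Poly n k] F.mod i)
    (hD : ∀ i, F.d i ∘ₗ D (i + 1) = D i ∘ₗ G.d i) (hD0 : εF ∘ₗ D 0 = 0) (i : ℕ) (x : G.mod i) :
    D i x ∈ maxIdeal n k • (⊤ : Submodule (Poly n k) (F.mod i)) := by
  -- This is the null-homotopy: `t` stands for the previous `s` composed with the differential of
  -- `G`, and is `0` for `i = 0`. Keeping only its two properties avoids the index `i - 1`.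
  have key : ∀ i, ∃ (s : G.mod i →ₗ[Poly n k] F.mod (i + 1)) (t : G.mod i →ₗ[Poly n k] F.mod i),
      D i = F.d i ∘ₗ s + t ∧ t ∘ₗ G.d i = 0 ∧
        ∀ x, t x ∈ maxIdeal n k • (⊤ : Submodule (Poly n k) (F.mod i)) := by
    intro i
    induction i with
    | zero =>
      obtain ⟨s, hs⟩ := exists_lift_of_mem_range (F.d 0) (D 0) fun x =>
        (hF.1.exact_zero _).1 (LinearMap.congr_fun hD0 x)
      exact ⟨s, 0, by rw [hs, add_zero], LinearMap.zero_comp _, fun x => Submodule.zero_mem _⟩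
    | succ i ih =>
      obtain ⟨s, t, hst, ht, -⟩ := ih
      obtain ⟨s', hs'⟩ := exists_lift_of_mem_range (F.d (i + 1)) (D (i + 1) - s ∘ₗ G.d i)
        fun x => (hF.1.exact_succ i _).1 <| by
          have h1 := LinearMap.congr_fun (hD i) x
          have h2 := LinearMap.congr_fun hst (G.d i x)
          have h3 := LinearMap.congr_fun ht x
          simp only [LinearMap.comp_apply, LinearMap.add_apply, LinearMap.zero_apply] at h1 h2 h3
          rw [LinearMap.sub_apply, map_sub, h1, h2, h3, LinearMap.comp_apply, add_zero, sub_self]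
      refine ⟨s', s ∘ₗ G.d i, by rw [hs']; exact (sub_add_cancel (D (i + 1)) (s ∘ₗ G.d i)).symm, ?_,
        fun x => ?_⟩
      · rw [LinearMap.comp_assoc, G.d_comp_d, LinearMap.comp_zero]
      · exact map_mem_maxIdeal_smul_top s (hG i (LinearMap.mem_range_self _ x))
  obtain ⟨s, t, hst, -, ht⟩ := key i
  rw [hst]
  exact Submodule.add_mem _ (hF.2 i (LinearMap.mem_range_self _ _)) (ht x)

/-- The coordinate of `x` at `b` is homogeneous of degree `j - deg b`, so it has a constant term
only when `deg b = j`. Hence graded maps taken modulo `𝔪` split into blocks, one for each degree. -/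
theorem _root_.GradedResolution.constantCoeff_sum_mul {ι κ : Type} {deg : ι → ℤ} [Fintype ι]
    {x : ι →₀ Poly n k} {j : ℤ} [Fintype {b // deg b = j}] (hx : x ∈ freeGrading deg j)
    (β : (ι →₀ Poly n k) →ₗ[Poly n k] (κ →₀ Poly n k)) (a : κ) :
    constantCoeff (β x a) = ∑ b : {b // deg b = j},
      constantCoeff (β (Finsupp.single b.1 1) a) * constantCoeff (x b.1) := by
  classical
  have h : x = ∑ b, x b • Finsupp.single b (1 : Poly n k) := by
    rw [← Finsupp.univ_sum_single x]
    simp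
  have h1 : constantCoeff (β x a) =
      ∑ b, constantCoeff (β (Finsupp.single b 1) a) * constantCoeff (x b) := by
    conv_lhs => rw [h, map_sum, Finsupp.finsetSum_apply, map_sum]
    refine Finset.sum_congr rfl fun b _ => ?_
    rw [map_smul, Finsupp.smul_apply, smul_eq_mul, map_mul, mul_comm]
  rw [h1, ← Finset.sum_subset (Finset.subset_univ (Finset.univ.filter fun b => deg b = j))]
  · exact Finset.sum_subtype _ (by simp) _
  · intro b _ hb
    rw [constantCoeff_eq_zero_of_mem_polyGrading (hx b), mul_zero]
    intro h0
    exact hb (by simp; linarith)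

/-- Lift the identity of `M` both ways, to `α : F → F'` and `β : F' → F`. Then `β ∘ α - id` lifts
zero, so `β ∘ α` is the identity modulo `𝔪`. In degree `j` this is a matrix identity `B * A = 1`
over `k`, which bounds the size by the rank of `A`. Minimality of `F'` plays no role; when both are
minimal, symmetry gives equality. -/
theorem IsMinimalResolution.rank_le {F' : FreeComplex n k} {εF' : F'.mod 0 →ₗ[Poly n k] M}
    (hc : IsComponents 𝓜 c) (hF : F.IsMinimalResolution 𝓜 εF) (hF' : F'.IsResolution 𝓜 εF')
    (i : ℕ) (j : ℤ) : F.rank i j ≤ F'.rank i j := by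
  classical
  obtain ⟨α, hα⟩ := hF'.exists_hom hc εF hF.1.graded hF.1.comp_d_zero
  obtain ⟨β, hβ⟩ := hF.1.exists_hom hc εF' hF'.graded hF'.comp_d_zero
  have hmem := hF.apply_mem_of_lift_zero hF.2 (fun i => β.f i ∘ₗ α.f i - LinearMap.id)
    (fun i => by
      rw [LinearMap.comp_sub, LinearMap.sub_comp, ← LinearMap.comp_assoc, β.comm,
        LinearMap.comp_assoc, α.comm, LinearMap.comp_assoc]
      rfl)
    (by rw [LinearMap.comp_sub, ← LinearMap.comp_assoc, hβ, hα, LinearMap.comp_id, sub_self]) i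
  have := F.finite i
  have := F'.finite i
  have := Fintype.ofFinite (F.ι i)
  have := Fintype.ofFinite (F'.ι i)
  let A : Matrix {b : F'.ι i // F'.deg i b = j} {b : F.ι i // F.deg i b = j} k :=
    fun b' b => constantCoeff (α.f i (Finsupp.single b.1 1) b'.1)
  let B : Matrix {b : F.ι i // F.deg i b = j} {b : F'.ι i // F'.deg i b = j} k :=
    fun b b' => constantCoeff (β.f i (Finsupp.single b'.1 1) b.1)
  have hBA : B * A = 1 := by
    ext a b
    have hb : α.f i (Finsupp.single b.1 1) ∈ F'.grading i j :=
      α.graded i j _ (single_mem_freeGrading (by rw [b.2, sub_self]; exact one_mem_polyGrading))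
    have h1 := mem_maxIdeal_smul_top_iff.1 (hmem (Finsupp.single b.1 1)) a.1
    rw [LinearMap.sub_apply, Finsupp.sub_apply, map_sub, LinearMap.comp_apply,
      constantCoeff_sum_mul hb, sub_eq_zero] at h1
    rw [Matrix.mul_apply, h1, LinearMap.id_apply, Finsupp.single_apply, Matrix.one_apply]
    simp only [Subtype.ext_iff, eq_comm (a := a.1)]
    split_ifs <;> simp
  rw [rank, rank, Nat.card_eq_fintype_card, Nat.card_eq_fintype_card,
    ← Matrix.rank_one (R := k) (n := {b : F.ι i // F.deg i b = j}), ← hBA]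
  exact (Matrix.rank_mul_le_right B A).trans A.rank_le_card_height

/-- The graded Betti numbers can be read off any minimal graded free resolution. -/
theorem IsMinimalResolution.betti_eq (hc : IsComponents 𝓜 c) (hF : F.IsMinimalResolution 𝓜 εF)
    (i : ℕ) (j : ℤ) : betti (n := n) 𝓜 i j = F.rank i j := by
  -- Excludes the default value `0` in the definition of `betti`.
  have h : ∃ (F : FreeComplex n k) (ε : F.mod 0 →ₗ[Poly n k] M), F.IsMinimalResolution 𝓜 ε :=
    ⟨F, εF, hF⟩
  rw [betti, dif_pos h]
  obtain ⟨ε, hε⟩ := h.choose_spec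
  exact le_antisymm (hε.rank_le hc hF.1 i j) (hF.rank_le hc hε.1 i j)

/-! ### Twists and mapping cones. -/

theorem IsResolution.twist (hF : F.IsResolution 𝓜 εF) (a : ℤ) :
    (F.twist a).IsResolution (GradedResolution.twist a 𝓜) εF where
  graded _ x hx := hF.graded _ x (mem_freeGrading_add.1 hx)
  surjective := hF.surjective
  exact_zero := hF.exact_zero
  exact_succ := hF.exact_succ

theorem rank_twist (F : FreeComplex n k) (a : ℤ) (i : ℕ) (j : ℤ) :
    (F.twist a).rank i j = F.rank i (j - a) :=
  Nat.card_congr (Equiv.subtypeEquivRight fun _ => eq_sub_iff_add_eq.symm)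

theorem rank_cone_succ (ψ : Hom G F) (i : ℕ) (j : ℤ) :
    (cone ψ).rank (i + 1) j = F.rank (i + 1) j + G.rank i j := by
  have := F.finite (i + 1)
  have := G.finite i
  exact (Nat.card_congr Equiv.subtypeSum).trans Nat.card_sum

theorem isMinimal_cone (ψ : Hom G F) (hF : F.IsMinimal) (hG : G.IsMinimal)
    (hψ : ∀ i x, ψ.f i x ∈ maxIdeal n k • (⊤ : Submodule (Poly n k) (F.mod i))) :
    (cone ψ).IsMinimal := by
  rintro (_ | i) _ ⟨z, rfl⟩
  · exact Submodule.add_mem _ (hF 0 (LinearMap.mem_range_self _ _)) (hψ 0 _)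
  · have h := coneEquiv_coneD_succ ψ i z
    rw [mem_maxIdeal_smul_top_iff]
    rintro (b | b)
    · have h1 := congrArg (fun p => p.1 b) h
      refine (congrArg constantCoeff h1).trans ?_
      exact mem_maxIdeal_smul_top_iff.1
        (Submodule.add_mem _ (hF _ (LinearMap.mem_range_self _ _)) (hψ _ _)) b
    · have h1 := congrArg (fun p => p.2 b) h
      refine (congrArg constantCoeff h1).trans ?_
      exact mem_maxIdeal_smul_top_iff.1
        (Submodule.neg_mem _ (hG _ (LinearMap.mem_range_self _ _))) b

/-- The mapping cone of a lift of the injection in a short exact sequence resolves the cokernel. -/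
theorem isResolution_cone {N Q : Type v} [AddCommGroup N] [AddCommGroup Q] [Module k N] [Module k Q]
    [Module (Poly n k) N] [Module (Poly n k) Q] {𝓝 : ℤ → Submodule k N} {𝓠 : ℤ → Submodule k Q}
    {εG : G.mod 0 →ₗ[Poly n k] N} (hF : F.IsResolution 𝓜 εF) (hG : G.IsResolution 𝓝 εG)
    {φ : N →ₗ[Poly n k] M} {π : M →ₗ[Poly n k] Q} (hπ : IsGradedMap 𝓜 𝓠 π)
    (hφ : Function.Injective φ) (hφπ : Function.Exact φ π) (hπs : Function.Surjective π)
    (ψ : Hom G F) (hψ : ψ.IsLift εF εG φ) : (cone ψ).IsResolution 𝓠 (π ∘ₗ εF) := by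
  have hψ0 : ∀ y, εF (ψ.f 0 y) = φ (εG y) := fun y => LinearMap.congr_fun hψ y
  have hc : ∀ i x, F.d i (ψ.f (i + 1) x) = ψ.f i (G.d i x) :=
    fun i x => LinearMap.congr_fun (ψ.comm i) x
  -- Here `εF x` comes from `N`, so it is hit by some `y` in `G_0`; then `x - ψ y` dies in `M` and
  -- is a boundary of `F`.
  have hker : ∀ x, π (εF x) = 0 → ∃ w y, F.d 0 w + ψ.f 0 y = x := by
    intro x hx
    obtain ⟨z, hz⟩ := (hφπ _).1 hx
    obtain ⟨y, rfl⟩ := hG.surjective z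
    obtain ⟨w, hw⟩ := (hF.exact_zero (x - ψ.f 0 y)).1 (by rw [map_sub, hψ0, hz, sub_self])
    exact ⟨w, y, by rw [hw, sub_add_cancel]⟩
  refine ⟨fun j x hx => hπ j _ (hF.graded j x hx), hπs.comp hF.surjective, ?_, ?_⟩
  · intro x
    constructor
    · intro hx
      obtain ⟨w, y, hwy⟩ := hker x hx
      refine ⟨(coneEquiv F G 0).symm (w, y), ?_⟩
      refine (coneD_zero_apply ψ _).trans ?_
      rw [LinearEquiv.apply_symm_apply]
      exact hwy
    · rintro ⟨z, rfl⟩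
      refine (congrArg (π ∘ₗ εF) (coneD_zero_apply ψ z)).trans ?_
      rw [LinearMap.comp_apply, map_add, hF.exact_zero.apply_apply_eq_zero, zero_add, hψ0,
        hφπ.apply_apply_eq_zero]
  · intro i z
    refine ⟨fun hz => ?_, fun ⟨w, hw⟩ => ?_⟩
    swap
    · rw [← hw]
      exact LinearMap.congr_fun (coneD_comp ψ i) w
    -- Once the `G`-part of the cycle `z` is minus the boundary of `y`, subtracting `ψ y` from the
    -- `F`-part leaves a cycle of `F`, hence a boundary.
    suffices h : ∃ y, G.d i y = -(coneEquiv F G i z).2 ∧ ∃ x, F.d (i + 1) x =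
        (coneEquiv F G i z).1 - ψ.f (i + 1) y by
      obtain ⟨y, hy, x, hx⟩ := h
      refine ⟨(coneEquiv F G (i + 1)).symm (x, y), (coneEquiv F G i).injective ?_⟩
      refine (coneEquiv_coneD_succ ψ i _).trans ?_
      rw [LinearEquiv.apply_symm_apply]
      simp [hx, hy]
    have main : (∃ y, G.d i y = -(coneEquiv F G i z).2) ∧
        F.d i (coneEquiv F G i z).1 + ψ.f i (coneEquiv F G i z).2 = 0 := by
      cases i with
      | zero =>
        have hz' : F.d 0 (coneEquiv F G 0 z).1 + ψ.f 0 (coneEquiv F G 0 z).2 = 0 := hz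
        refine ⟨(hG.exact_zero _).1 ?_, hz'⟩
        -- At the bottom there is no cycle condition in `G`; applying `εF` shows that `φ` kills the
        -- class of the `G`-part, and injectivity of `φ` makes that part a boundary.
        have h := congrArg εF hz'
        rw [map_add, hF.exact_zero.apply_apply_eq_zero, zero_add, hψ0, map_zero] at h
        rw [map_neg, neg_eq_zero]
        exact hφ (h.trans (map_zero φ).symm)
      | succ i =>
        have h := coneEquiv_coneD_succ ψ i z
        have hz' : coneD ψ (i + 1) z = 0 := hz
        rw [hz', map_zero] at h
        refine ⟨(hG.exact_succ i _).1 ?_, (congrArg Prod.fst h).symm⟩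
        rw [map_neg]
        exact (congrArg Prod.snd h).symm
    obtain ⟨⟨y, hy⟩, h⟩ := main
    refine ⟨y, hy, (hF.exact_succ i _).1 ?_⟩
    rw [map_sub, hc, hy, map_neg, sub_neg_eq_add, h]

end FreeComplex

/-! ### Suprema of translated sets. -/

section Suprema

/-- Translation by `a` is monotone with monotone inverse, translation by `-a`, so it preserves all
suprema, infinite values included. -/
theorem WithBot.WithTop.sSup_add_coe (S : Set (WithBot (WithTop ℤ))) (a : ℤ) :
    sSup ((· + ((a : WithTop ℤ) : WithBot (WithTop ℤ))) '' S) =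
      sSup S + ((a : WithTop ℤ) : WithBot (WithTop ℤ)) := by
  have hmono : ∀ a : ℤ, Monotone (· + ((a : WithTop ℤ) : WithBot (WithTop ℤ))) :=
    fun a x y h => add_le_add_left h _
  have hinv : ∀ (a b : ℤ) (x : WithBot (WithTop ℤ)), a + b = 0 →
      x + ((a : WithTop ℤ) : WithBot (WithTop ℤ)) + ((b : WithTop ℤ) : WithBot (WithTop ℤ)) = x := by
    intro a b x hab
    rw [add_assoc, ← WithBot.coe_add, ← WithTop.coe_add, hab, WithTop.coe_zero, WithBot.coe_zero,
      add_zero]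
  refine le_antisymm (sSup_le ?_) ?_
  · rintro _ ⟨x, hx, rfl⟩
    exact hmono a (le_sSup hx)
  · refine (hmono a (sSup_le fun x hx => ?_)).trans (hinv (-a) a (sSup _) (by ring)).le
    exact (hinv a (-a) x (by ring)).ge.trans (hmono (-a) (le_sSup ⟨x, hx, rfl⟩))

/-- Adding `1` is not invertible here, since `0` is not a value. If `S` contains an element other
than `⊥`, the supremum of the translate is at least `1` and `1` can be subtracted; otherwise `sSup S
+ 1` is `⊥`. -/
theorem WithBot.ENat.sSup_add_one (S : Set (WithBot ℕ∞)) :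
    sSup ((· + 1) '' S) = sSup S + 1 := by
  refine le_antisymm (sSup_le ?_) ?_
  · rintro _ ⟨x, hx, rfl⟩
    exact add_le_add_left (le_sSup hx) _
  · by_cases hS : ∀ x ∈ S, x = ⊥
    · rw [sSup_eq_bot.2 hS, WithBot.bot_add]
      exact bot_le
    push Not at hS
    obtain ⟨x, hx, hx0⟩ := hS
    lift x to ℕ∞ using hx0
    have hle : ∀ y ∈ S, y + 1 ≤ sSup ((· + 1) '' S) := fun y hy => le_sSup ⟨y, hy, rfl⟩
    generalize sSup ((· + 1) '' S) = t at hle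
    have hxt := hle _ hx
    induction t with
    | bot => exact absurd (le_bot_iff.1 hxt) (WithBot.coe_ne_bot (a := x + 1))
    | coe t =>
      have h1 : 1 ≤ t := le_trans le_add_self ((WithBot.coe_le_coe (a := x + 1)).1 hxt)
      have ht : ((t - 1 : ℕ∞) : WithBot ℕ∞) + 1 = t := by
        rw [← WithBot.coe_one, ← WithBot.coe_add, tsub_add_cancel_of_le h1]
      rw [← ht]
      refine add_le_add_left (sSup_le fun y hy => ?_) _
      induction y with
      | bot => exact bot_le
      | coe y =>
        have hy1 : y + 1 ≤ t := WithBot.coe_le_coe.1 (hle _ hy)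
        exact WithBot.coe_le_coe.2 (ENat.le_sub_of_add_le_right ENat.one_ne_top hy1)

end Suprema

/-! ### Regularity and projective dimension from the Betti numbers. -/

section Invariants

variable {n : ℕ} {k : Type u} [Field k] {M : Type v} {N Q : Type w} [AddCommGroup M]
  [AddCommGroup N] [AddCommGroup Q] [Module k M] [Module k N] [Module k Q]
  [Module (Poly n k) M] [Module (Poly n k) N] [Module (Poly n k) Q]
  {𝓜 : ℤ → Submodule k M} {𝓝 : ℤ → Submodule k N} {𝓠 : ℤ → Submodule k Q}

/-- A sum of natural numbers is nonzero exactly when one of its terms is, so the nonzero positions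
for `𝓠` are those for `𝓜` together with those for `𝓝` moved from `(i, j)` to `(i + 1, j + d)`. The
move raises `j - i` by `d - 1`, and the supremum of a union is a maximum. -/
theorem reg_eq_max {d : ℤ} (h0 : ∀ j, betti (n := n) 𝓠 0 j = betti (n := n) 𝓜 0 j)
    (hs : ∀ (i : ℕ) (j : ℤ), betti (n := n) 𝓠 (i + 1) j =
      betti (n := n) 𝓜 (i + 1) j + betti (n := n) 𝓝 i (j - d)) :
    reg (n := n) 𝓠 =
      max (reg (n := n) 𝓜) (reg (n := n) 𝓝 + (((d - 1 : ℤ) : WithTop ℤ) : WithBot (WithTop ℤ))) := by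
  rw [reg, reg, reg, ← WithBot.WithTop.sSup_add_coe, ← sSup_union]
  congr 1
  ext r
  constructor
  · rintro ⟨_ | i, j, hij, rfl⟩
    · exact Or.inl ⟨0, j, h0 j ▸ hij, rfl⟩
    · by_cases hM : betti (n := n) 𝓜 (i + 1) j = 0
      · rw [hs, hM, zero_add] at hij
        refine Or.inr ⟨_, ⟨i, j - d, hij, rfl⟩, ?_⟩
        change _ + _ = _
        rw [← WithBot.coe_add, ← WithTop.coe_add]
        congr 2
        push_cast
        ring
      · exact Or.inl ⟨i + 1, j, hM, rfl⟩
  · rintro (⟨_ | i, j, hij, rfl⟩ | ⟨_, ⟨i, j, hij, rfl⟩, rfl⟩)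
    · exact ⟨0, j, by rwa [h0], rfl⟩
    · exact ⟨i + 1, j, by rw [hs]; omega, rfl⟩
    · refine ⟨i + 1, j + d, by rw [hs, add_sub_cancel_right]; omega, ?_⟩
      change _ + _ = _
      rw [← WithBot.coe_add, ← WithTop.coe_add]
      congr 2
      push_cast
      ring

theorem pd_eq_max {d : ℤ} (h0 : ∀ j, betti (n := n) 𝓠 0 j = betti (n := n) 𝓜 0 j)
    (hs : ∀ (i : ℕ) (j : ℤ), betti (n := n) 𝓠 (i + 1) j =
      betti (n := n) 𝓜 (i + 1) j + betti (n := n) 𝓝 i (j - d)) :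
    pd (n := n) 𝓠 = max (pd (n := n) 𝓜) (pd (n := n) 𝓝 + 1) := by
  rw [pd, pd, pd, ← WithBot.ENat.sSup_add_one, ← sSup_union]
  congr 1
  ext r
  constructor
  · rintro ⟨_ | i, j, hij, rfl⟩
    · exact Or.inl ⟨0, j, h0 j ▸ hij, rfl⟩
    · by_cases hM : betti (n := n) 𝓜 (i + 1) j = 0
      · rw [hs, hM, zero_add] at hij
        exact Or.inr ⟨_, ⟨i, j - d, hij, rfl⟩, rfl⟩
      · exact Or.inl ⟨i + 1, j, hM, rfl⟩
  · rintro (⟨_ | i, j, hij, rfl⟩ | ⟨_, ⟨i, j, hij, rfl⟩, rfl⟩)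
    · exact ⟨0, j, by rwa [h0], rfl⟩
    · exact ⟨i + 1, j, by rw [hs]; omega, rfl⟩
    · exact ⟨i + 1, j + d, by rw [hs, add_sub_cancel_right]; omega, rfl⟩

end Invariants

/-! ### The short exact sequence of multiplication by `f`, and minimality of its cone. -/

section Multiplication

variable {n : ℕ} {k : Type u} [Field k] (I : Ideal (Poly n k)) (f : Poly n k)

theorem mulMap_mk (g : Poly n k) :
    mulMap I f (Submodule.Quotient.mk g) = Submodule.Quotient.mk (g * f) := rfl

theorem projMap_mk (g : Poly n k) :
    projMap I f (Submodule.Quotient.mk g) = Submodule.Quotient.mk g := rfl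

theorem isGradedMap_mulMap {d : ℕ} (hf : f.IsHomogeneous d) :
    IsGradedMap (twist (d : ℤ) (quotGrading (I.colon {f}))) (quotGrading I) (mulMap I f) := by
  rintro j _ ⟨g, hg, rfl⟩
  refine ⟨g * f, ?_, rfl⟩
  have := mul_mem_polyGrading hg (mem_polyGrading_natCast.2 hf)
  rwa [sub_add_cancel] at this

theorem isGradedMap_projMap : IsGradedMap (quotGrading I)
    (quotGrading (I ⊔ Ideal.span {f})) (projMap I f) := by
  rintro j _ ⟨g, hg, rfl⟩
  exact ⟨g, hg, rfl⟩

theorem mulMap_injective : Function.Injective (mulMap I f) := by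
  rw [injective_iff_map_eq_zero]
  intro x hx
  obtain ⟨g, rfl⟩ := Submodule.Quotient.mk_surjective _ x
  rw [mulMap_mk, Submodule.Quotient.mk_eq_zero] at hx
  rwa [Submodule.Quotient.mk_eq_zero, Submodule.mem_colon_singleton]

theorem exact_mulMap_projMap : Function.Exact (mulMap I f) (projMap I f) := by
  intro x
  obtain ⟨g, rfl⟩ := Submodule.Quotient.mk_surjective _ x
  rw [projMap_mk, Submodule.Quotient.mk_eq_zero, Submodule.mem_sup]
  constructor
  · rintro ⟨a, ha, b, hb, rfl⟩
    obtain ⟨c, rfl⟩ := Ideal.mem_span_singleton'.1 hb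
    refine ⟨Submodule.Quotient.mk c, ?_⟩
    rw [mulMap_mk, eq_comm, Submodule.Quotient.eq]
    simpa using ha
  · rintro ⟨y, hy⟩
    obtain ⟨c, rfl⟩ := Submodule.Quotient.mk_surjective _ y
    rw [mulMap_mk, eq_comm, Submodule.Quotient.eq] at hy
    exact ⟨_, hy, c * f, Ideal.mem_span_singleton'.2 ⟨c, rfl⟩, sub_add_cancel _ _⟩

theorem projMap_surjective : Function.Surjective (projMap I f) :=
  Submodule.factor_surjective le_sup_left

variable {I f} {F G : FreeComplex n k} {εF : F.mod 0 →ₗ[Poly n k] (Poly n k ⧸ I)}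
  {εG : G.mod 0 →ₗ[Poly n k] (Poly n k ⧸ I.colon {f})}

/-- A graded map out of the twist of the quotient lifts to a chain map. -/
theorem exists_hom_twist (hI : I.IsHomogeneous (homogeneousSubmodule (Fin n) k))
    {J : Ideal (Poly n k)}
    {εG : G.mod 0 →ₗ[Poly n k] (Poly n k ⧸ J)} (hF : F.IsResolution (quotGrading I) εF)
    (hG : G.IsResolution (quotGrading J) εG) {d : ℕ}
    {φ : (Poly n k ⧸ J) →ₗ[Poly n k] (Poly n k ⧸ I)}
    (hφ : IsGradedMap (twist (d : ℤ) (quotGrading J)) (quotGrading I) φ) :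
    ∃ ψ : FreeComplex.Hom (G.twist d) F, ψ.IsLift εF εG φ := by
  obtain ⟨c, hc⟩ := exists_isComponents_quot hI
  refine hF.exists_hom (G := G.twist d) hc (φ ∘ₗ εG)
    (fun j x hx => hφ j _ ((hG.twist d).graded j x hx)) ?_
  exact (LinearMap.comp_assoc _ _ _).trans
    ((congrArg (φ ∘ₗ ·) (hG.twist d).comp_d_zero).trans (LinearMap.comp_zero φ))

/-- If `f = h₁ h₂` with `h₂ ∈ 𝔪` and `(I : f) = (I : h₁)`, then every lift of multiplication by `f`
to minimal resolutions vanishes modulo `𝔪`: it is homotopic to `h₂` times a lift of `h₁`. -/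
theorem lift_apply_mem (hI : I.IsHomogeneous (homogeneousSubmodule (Fin n) k))
    (hF : F.IsMinimalResolution (quotGrading I) εF)
    (hG : G.IsMinimalResolution (quotGrading (I.colon {f})) εG)
    {h₁ h₂ : Poly n k} {d₁ d : ℕ} (hh₁ : h₁.IsHomogeneous d₁) (hh₂ : h₂ ∈ maxIdeal n k)
    (hf : f = h₁ * h₂) (hcolon : I.colon {f} = I.colon {h₁})
    (ψ : FreeComplex.Hom (G.twist d) F) (hψ : ψ.IsLift εF εG (mulMap I f)) (i : ℕ) (x : G.mod i) :
    ψ.f i x ∈ maxIdeal n k • (⊤ : Submodule (Poly n k) (F.mod i)) := by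
  have hle : I.colon {f} ≤ I.colon {h₁} := hcolon.le
  -- Multiplication by `h₁` on `R/(I : f)`, well defined because `(I : f) ≤ (I : h₁)`.
  let μ : (Poly n k ⧸ I.colon {f}) →ₗ[Poly n k] (Poly n k ⧸ I) :=
    mulMap I h₁ ∘ₗ Submodule.factor hle
  have hμ : IsGradedMap (twist (d₁ : ℤ) (quotGrading (I.colon {f}))) (quotGrading I) μ := by
    rintro j _ ⟨g, hg, rfl⟩
    exact isGradedMap_mulMap I h₁ hh₁ j _ ⟨g, hg, rfl⟩
  have hμf : mulMap I f = h₂ • μ := by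
    refine LinearMap.ext fun y => ?_
    obtain ⟨g, rfl⟩ := Submodule.Quotient.mk_surjective _ y
    change Submodule.Quotient.mk (g * f) = Submodule.Quotient.mk (h₂ • (g * h₁))
    rw [hf, smul_eq_mul]
    congr 1
    ring
  obtain ⟨χ, hχ⟩ := exists_hom_twist hI hF.1 hG.1 hμ
  -- The lifts `ψ` and `χ` start from different twists of `G`. A twist changes only degrees, so as
  -- plain linear maps both start from `G` and can be subtracted.
  let ψf : ∀ i, G.mod i →ₗ[Poly n k] F.mod i := ψ.f
  let χf : ∀ i, G.mod i →ₗ[Poly n k] F.mod i := χ.f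
  have hψc : ∀ i, F.d i ∘ₗ ψf (i + 1) = ψf i ∘ₗ G.d i := ψ.comm
  have hχc : ∀ i, F.d i ∘ₗ χf (i + 1) = χf i ∘ₗ G.d i := χ.comm
  have hψ0 : εF ∘ₗ ψf 0 = mulMap I f ∘ₗ εG := hψ
  have hχ0 : εF ∘ₗ χf 0 = μ ∘ₗ εG := hχ
  have h := hF.apply_mem_of_lift_zero hG.2 (fun i => ψf i - h₂ • χf i)
    (fun i => by
      rw [LinearMap.comp_sub, LinearMap.comp_smul, LinearMap.sub_comp, LinearMap.smul_comp, hψc,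
        hχc])
    (by
      rw [LinearMap.comp_sub, LinearMap.comp_smul, hψ0, hχ0, hμf, LinearMap.smul_comp, sub_self])
    i x
  have h' : h₂ • χf i x ∈ maxIdeal n k • (⊤ : Submodule (Poly n k) (F.mod i)) :=
    Submodule.smul_mem_smul hh₂ trivial
  have := Submodule.add_mem _ h h'
  rwa [LinearMap.sub_apply, LinearMap.smul_apply, sub_add_cancel] at this

theorem isMinimalResolution_cone (hI : I.IsHomogeneous (homogeneousSubmodule (Fin n) k))
    (hF : F.IsMinimalResolution (quotGrading I) εF)
    (hG : G.IsMinimalResolution (quotGrading (I.colon {f})) εG)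
    {h₁ h₂ : Poly n k} {d₁ d : ℕ} (hh₁ : h₁.IsHomogeneous d₁) (hh₂ : h₂ ∈ maxIdeal n k)
    (hf : f = h₁ * h₂) (hcolon : I.colon {f} = I.colon {h₁})
    (ψ : FreeComplex.Hom (G.twist d) F) (hψ : ψ.IsLift εF εG (mulMap I f)) :
    (FreeComplex.cone ψ).IsMinimalResolution (quotGrading (I ⊔ Ideal.span {f}))
      (projMap I f ∘ₗ εF) :=
  ⟨FreeComplex.isResolution_cone hF.1 (hG.1.twist d) (isGradedMap_projMap I f)
      (mulMap_injective I f) (exact_mulMap_projMap I f) (projMap_surjective I f) ψ hψ,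
    FreeComplex.isMinimal_cone ψ hF.2 hG.2 (lift_apply_mem hI hF hG hh₁ hh₂ hf hcolon ψ hψ)⟩

end Multiplication

end GradedResolution

end

/-! ### The main theorem. -/

theorem theorem2p2 {n : ℕ} {k : Type*} [Field k]
    (I : Ideal (MvPolynomial (Fin n) k))
    (hI : I.IsHomogeneous (MvPolynomial.homogeneousSubmodule (Fin n) k))
    (f : MvPolynomial (Fin n) k) (d : ℕ) (hf : f.IsHomogeneous d) (hfI : f ∉ I) :
    -- the graded short exact sequence `0 → R/(I:f)(-d) → R/I → R/(I+(f)) → 0`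
    (IsGradedMap
        (twist (d : ℤ) (quotGrading (I.colon {f})))
        (quotGrading I) (mulMap I f) ∧
      IsGradedMap (quotGrading I)
        (quotGrading (I ⊔ Ideal.span {f})) (projMap I f) ∧
      Function.Injective (mulMap I f) ∧
      Function.Exact (mulMap I f) (projMap I f) ∧
      Function.Surjective (projMap I f)) ∧
    ∀ (h₁ h₂ : MvPolynomial (Fin n) k) (d₁ d₂ : ℕ), h₁.IsHomogeneous d₁ → h₂.IsHomogeneous d₂ →
      0 < d₂ → f = h₁ * h₂ → I.colon {f} = I.colon {h₁} →
      -- the multiplication map lifts, and the mapping cone of every lift is minimal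
      (∀ (F G : FreeComplex n k)
          (εF : F.mod 0 →ₗ[MvPolynomial (Fin n) k] (MvPolynomial (Fin n) k ⧸ I))
          (εG : G.mod 0 →ₗ[MvPolynomial (Fin n) k] (MvPolynomial (Fin n) k ⧸ I.colon {f})),
          F.IsMinimalResolution (quotGrading I) εF →
          G.IsMinimalResolution (quotGrading (I.colon {f})) εG →
          (∃ ψ : FreeComplex.Hom (G.twist d) F,
            ψ.IsLift εF εG (mulMap I f)) ∧
          ∀ ψ : FreeComplex.Hom (G.twist d) F,
            ψ.IsLift εF εG (mulMap I f) →
            (FreeComplex.cone ψ).IsMinimalResolution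
              (quotGrading (I ⊔ Ideal.span {f}))
              (projMap I f ∘ₗ εF)) ∧
      -- (a) the graded Betti numbers, with `β_{-1,j} = 0`
      (∀ j : ℤ, betti (n := n)
            (quotGrading (I ⊔ Ideal.span {f})) 0 j =
          betti (n := n) (quotGrading I) 0 j) ∧
      (∀ (i : ℕ) (j : ℤ), betti (n := n)
            (quotGrading (I ⊔ Ideal.span {f})) (i + 1) j =
          betti (n := n) (quotGrading I) (i + 1) j +
          betti (n := n) (quotGrading (I.colon {f})) i (j - d)) ∧
      -- (b) the regularity
      reg (n := n) (quotGrading (I ⊔ Ideal.span {f})) =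
        max (reg (n := n) (quotGrading I))
          (reg (n := n) (quotGrading (I.colon {f})) +
            (((d - 1 : ℤ) : WithTop ℤ) : WithBot (WithTop ℤ))) ∧
      -- (c) the projective dimension
      pd (n := n) (quotGrading (I ⊔ Ideal.span {f})) =
        max (pd (n := n) (quotGrading I))
          (pd (n := n) (quotGrading (I.colon {f})) + 1) := by
  refine ⟨⟨isGradedMap_mulMap I f hf, isGradedMap_projMap I f, mulMap_injective I f,
    exact_mulMap_projMap I f, projMap_surjective I f⟩, ?_⟩
  intro h₁ h₂ d₁ d₂ hh₁ hh₂ hd₂ hfh hcolon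
  have hh₂' : h₂ ∈ maxIdeal n k :=
    mem_maxIdeal_iff.2 (hh₂.coeff_eq_zero (by simpa using hd₂.ne))
  have hlift := fun {F G : FreeComplex n k} {εF} {εG}
      (hF : F.IsMinimalResolution (quotGrading I) εF)
      (hG : G.IsMinimalResolution (quotGrading (I.colon {f})) εG) =>
    exists_hom_twist hI hF.1 hG.1 (isGradedMap_mulMap I f hf)
  -- From `f ∉ I` both `I` and `(I : f)` are proper: `1 ∈ (I : f)` would mean `f ∈ I`.
  obtain ⟨F, εF, hF⟩ := exists_isMinimalResolution hI fun h => hfI (h ▸ Submodule.mem_top)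
  obtain ⟨G, εG, hG⟩ := exists_isMinimalResolution (isHomogeneous_colon hI hf) fun h => hfI <| by
    have h1 : (1 : MvPolynomial (Fin n) k) ∈ I.colon {f} := h ▸ Submodule.mem_top
    simpa [Submodule.mem_colon_singleton] using h1
  obtain ⟨ψ, hψ⟩ := hlift hF hG
  have hcone := isMinimalResolution_cone hI hF hG hh₁ hh₂' hfh hcolon ψ hψ
  obtain ⟨c, hc⟩ := exists_isComponents_quot hI
  obtain ⟨c', hc'⟩ := exists_isComponents_quot (isHomogeneous_colon hI hf)
  obtain ⟨e, he⟩ := exists_isComponents_quot (isHomogeneous_sup_span hI hf)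
  have h0 : ∀ j : ℤ, betti (n := n) (quotGrading (I ⊔ Ideal.span {f})) 0 j =
      betti (n := n) (quotGrading I) 0 j := fun j => by
    -- What remains is definitional, as the cone in homological degree `0` is `F_0`.
    rw [hcone.betti_eq he, hF.betti_eq hc]
    rfl
  have hs : ∀ (i : ℕ) (j : ℤ), betti (n := n) (quotGrading (I ⊔ Ideal.span {f})) (i + 1) j =
      betti (n := n) (quotGrading I) (i + 1) j +
        betti (n := n) (quotGrading (I.colon {f})) i (j - d) := fun i j => by
    rw [hcone.betti_eq he, hF.betti_eq hc, hG.betti_eq hc', FreeComplex.rank_cone_succ,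
      FreeComplex.rank_twist]
  exact ⟨fun F G εF εG hF hG =>
    ⟨hlift hF hG, isMinimalResolution_cone hI hF hG hh₁ hh₂' hfh hcolon⟩,
    h0, hs, reg_eq_max h0 hs, pd_eq_max h0 hs⟩
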